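/- Let $G$ be a compact Lie group with Lie algebra $\mathfrak{g}$, and let $h_t$, $t\in(-\varepsilon,\varepsilon)$ with $\varepsilon>0$, be a family of left-invariant Riemannian metrics on $G$ with $h_0$ bi-invariant. Write $\langle A,B\rangle=h_0(A,B)$ for $A,B\in\mathfrak{g}$, and let $\Phi_t:\mathfrak{g}\to\mathfrak{g}$ be the linear isomorphism determined by $h_t(A,B)=\langle\Phi_tA,B\rangle$ for all $A,B\in\mathfrak{g}$. Assume that $\Phi_t$ is inverse-linear, i.e. there is a linear map $\Psi:\mathfrak{g}\to\mathfrak{g}$ with $\Phi_t^{-1}=I-t\Psi$ for all $t\in(-\varepsilon,\varepsilon)$. Let $X,Y\in\mathfrak{g}$ with $[X,Y]=0$, and let $$\kappa(t)=h_t\big(R_t(\Phi_t^{-1}X,\Phi_t^{-1}Y)\Phi_t^{-1}Y,\ \Phi_t^{-1}X\big)$$ be the unnormalized sectional curvature of $\Phi_t^{-1}X$ and $\Phi_t^{-1}Y$ with respect to $h_t$, where $R_t(A,B)C=\nabla_A\nabla_BC-\nabla_B\nabla_AC-\nabla_{[A,B]}C$ is the curvature tensor of the Levi-Civita connection $\nabla$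 of $h_t$. Then $\kappa$ is three times continuously differentiable near $0$, $\kappa(0)=0$, $\kappa'(0)=0$, $\kappa''(0)=0$, and \begin{align*} \tfrac16\kappa'''(0)={}&\langle[X,\Psi Y]+[\Psi X,Y],[\Psi X,\Psi Y]\rangle+\langle[\Psi X,X],\Psi[\Psi Y,Y]\rangle\\ &-\langle[X,\Psi Y],\Psi[X,\Psi Y]\rangle-\langle[X,\Psi Y],\Psi[\Psi X,Y]\rangle-\langle[\Psi X,Y],\Psi[\Psi X,Y]\rangle . \end{align*} -/

import Mathlib

open Bundle VectorField Filter
open scoped Manifold ContDiff Topology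

noncomputable section

namespace LieGroupCurvature

/-! ### Riemannian metrics, the Levi-Civita connection and curvature -/

section Manifold

variable {E : Type*} [NormedAddCommGroup E] [NormedSpace ℝ E]
  {M : Type*} [TopologicalSpace M] [ChartedSpace E M]

/-- Smooth Riemannian metrics on a manifold `M` modelled on `E`; `g.inner x v w` is the inner
product of `v, w ∈ T_x M`. -/
abbrev Metric (E : Type*) [NormedAddCommGroup E] [NormedSpace ℝ E]
    (M : Type*) [TopologicalSpace M] [ChartedSpace E M] [IsManifold 𝓘(ℝ, E) ∞ M] : Type _ :=
  ContMDiffRiemannianMetric 𝓘(ℝ, E) ∞ E (TangentSpace 𝓘(ℝ, E) : M → Type _)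

/-- Affine connections on `M`. For `D : Connection E M` and vector fields `X`, `Y`, the value of
`∇_X Y` at `x` is `D Y x (X x)`. -/
abbrev Connection (E : Type*) [NormedAddCommGroup E] [NormedSpace ℝ E]
    (M : Type*) [TopologicalSpace M] [ChartedSpace E M] [IsManifold 𝓘(ℝ, E) ∞ M] : Type _ :=
  CovariantDerivative 𝓘(ℝ, E) E (TangentSpace 𝓘(ℝ, E) : M → Type _)

/-- `D` is the Levi-Civita connection of `g`: it is torsion-free, and it is compatible with `g`,
that is, `X (g(Y, Z)) = g(∇_X Y, Z) + g(Y, ∇_X Z)`. -/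
structure IsLeviCivita [FiniteDimensional ℝ E] [IsManifold 𝓘(ℝ, E) ∞ M]
    (g : Metric E M) (D : Connection E M) : Prop where
  torsion_eq_zero : D.torsion = 0
  compatible : ∀ (x : M) (v : TangentSpace 𝓘(ℝ, E) x)
    (Y Z : Π y : M, TangentSpace 𝓘(ℝ, E) y),
    MDifferentiableAt 𝓘(ℝ, E) 𝓘(ℝ, E).tangent
      (fun y => (TotalSpace.mk' E y (Y y) : TangentBundle 𝓘(ℝ, E) M)) x →
    MDifferentiableAt 𝓘(ℝ, E) 𝓘(ℝ, E).tangent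
      (fun y => (TotalSpace.mk' E y (Z y) : TangentBundle 𝓘(ℝ, E) M)) x →
    mfderiv 𝓘(ℝ, E) 𝓘(ℝ, ℝ) (fun y => g.inner y (Y y) (Z y)) x v
      = g.inner x (D Y x v) (Z x) + g.inner x (Y x) (D Z x v)

/-- The curvature `R(X, Y) Z = ∇_X ∇_Y Z - ∇_Y ∇_X Z - ∇_{[X, Y]} Z` at the point `x`. -/
def curvature [IsManifold 𝓘(ℝ, E) ∞ M] (D : Connection E M)
    (X Y Z : Π y : M, TangentSpace 𝓘(ℝ, E) y) (x : M) : TangentSpace 𝓘(ℝ, E) x :=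
  D (fun y => D Z y (Y y)) x (X x) - D (fun y => D Z y (X y)) x (Y x)
    - D Z x (mlieBracket 𝓘(ℝ, E) X Y x)

open scoped Classical in
/-- The unnormalized sectional curvature `g(R(X, Y) Y, X)` at `x` of smooth vector fields `X`, `Y`,
computed with the Levi-Civita connection of `g`. That connection exists and is unique on
differentiable vector fields, so the value `0` in the second branch is never taken. -/
def sectionalCurvature [FiniteDimensional ℝ E] [IsManifold 𝓘(ℝ, E) ∞ M]
    (g : Metric E M) (X Y : Π y : M, TangentSpace 𝓘(ℝ, E) y) (x : M) : ℝ :=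
  if hg : ∃ D : Connection E M, IsLeviCivita g D then
    g.inner x (curvature hg.choose X Y Y x) (X x)
  else 0

end Manifold

/-! ### Invariant metrics on Lie groups -/

section Group

variable {E : Type*} [NormedAddCommGroup E] [NormedSpace ℝ E]
  {G : Type*} [TopologicalSpace G] [ChartedSpace E G] [Group G] [LieGroup 𝓘(ℝ, E) ∞ G]

/-- All left translations are isometries of `g`. -/
def IsLeftInvariant (g : Metric E G) : Prop :=
  ∀ (a x : G) (v w : TangentSpace 𝓘(ℝ, E) x),
    g.inner (a * x) (mfderiv 𝓘(ℝ, E) 𝓘(ℝ, E) (fun y : G => a * y) x v)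
      (mfderiv 𝓘(ℝ, E) 𝓘(ℝ, E) (fun y : G => a * y) x w) = g.inner x v w

/-- All right translations are isometries of `g`. -/
def IsRightInvariant (g : Metric E G) : Prop :=
  ∀ (a x : G) (v w : TangentSpace 𝓘(ℝ, E) x),
    g.inner (x * a) (mfderiv 𝓘(ℝ, E) 𝓘(ℝ, E) (fun y : G => y * a) x v)
      (mfderiv 𝓘(ℝ, E) 𝓘(ℝ, E) (fun y : G => y * a) x w) = g.inner x v w

/-- A metric is bi-invariant if it is left- and right-invariant. -/
def IsBiInvariant (g : Metric E G) : Prop :=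
  IsLeftInvariant g ∧ IsRightInvariant g

/-- The unnormalized sectional curvature with respect to `g` of the elements `Z₁`, `Z₂` of the Lie
algebra of `G`, regarded as left-invariant vector fields, at the identity. -/
def lieSectionalCurvature [FiniteDimensional ℝ E] (g : Metric E G)
    (Z₁ Z₂ : GroupLieAlgebra 𝓘(ℝ, E) G) : ℝ :=
  sectionalCurvature g (mulInvariantVectorField Z₁) (mulInvariantVectorField Z₂) 1

end Group

end LieGroupCurvature

end

/-! On left-invariant fields the Levi-Civita connection is an algebraic product `N` on the Lie
algebra, fixed by Koszul's formula, so the curvature at the identity is algebraic in `N`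
(`lieSectionalCurvature_eq`). Ad-invariance of `h 0` turns Koszul's formula into 2Φ(N a b) = Φ[a,b]
+ [a,Φb] - [Φa,b].

Put x = Φ⁻¹X and y = Φ⁻¹Y. As [X,Y] = 0, the vectors [x,y], N x x, N y y, N x y and N y x are all
O(t), and κ = -h_t(N y y, N x x) + h_t(N x y, N y x) - h_t(N [x,y] y, x) is O(t²). With p = [X,ΨY]
and q = [ΨX,Y], the last two terms contribute -⟨p,q⟩ at order t²; the first contributes
-⟨[ΨX,X],[ΨY,Y]⟩, which is +⟨p,q⟩ by the Jacobi identity. Hence κ = t³ s(t) exactly, with s(0) the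
claimed expression (`curvature_expansion`). Since Φ_t inverts 1 - tΨ, s is smooth near 0, and
Leibniz' rule gives the derivatives.

Two geometric inputs remain: the Levi-Civita connection exists
(`IsLeftInvariant.exists_isLeviCivita`), and a bi-invariant metric is ad-invariant
(`IsBiInvariant.metricForm_lie_add`). -/

noncomputable section

namespace LieGroupCurvature

/-! ### Levi-Civita products on a Lie algebra with an inner product -/

section Algebra

variable {V : Type*} [LieRing V] [LieAlgebra ℝ V]

/-- `N` is the Levi-Civita product of the inner product `ip` on the Lie algebra `V`: it is
torsion-free, and `N a` is skew-symmetric for every `a`. -/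
structure IsLeviCivitaProduct (ip : LinearMap.BilinForm ℝ V) (N : V → V → V) : Prop where
  torsion_eq_zero : ∀ a b, N a b - N b a = ⁅a, b⁆
  skew : ∀ a b c, ip (N a b) c + ip b (N a c) = 0

/-- Torsion-freeness writes each bracket through `N`; three cyclic instances of skewness then cancel
all but one term. Uniqueness of `N` follows, the right-hand side being free of it. -/
theorem IsLeviCivitaProduct.koszul {ip : LinearMap.BilinForm ℝ V} {N : V → V → V}
    (hN : IsLeviCivitaProduct ip N) (hs : ∀ a b, ip a b = ip b a) (a b c : V) :
    2 * ip (N a b) c = ip ⁅a, b⁆ c - ip ⁅b, c⁆ a + ip ⁅c, a⁆ b := by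
  rw [← hN.torsion_eq_zero a b, ← hN.torsion_eq_zero b c, ← hN.torsion_eq_zero c a]
  simp only [map_sub, LinearMap.sub_apply]
  have h1 := hN.skew a b c
  have h2 := hN.skew b c a
  have h3 := hN.skew c a b
  linarith [hs b (N a c), hs c (N b a), hs a (N c b)]

theorem eq_of_forall_inner_eq {ip : LinearMap.BilinForm ℝ V}
    (hp : ∀ a, a ≠ 0 → 0 < ip a a) {a b : V} (h : ∀ c, ip a c = ip b c) : a = b := by
  by_contra hab
  have h1 := hp (a - b) (sub_ne_zero.2 hab)
  simp [h] at h1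

theorem IsLeviCivitaProduct.unique {ip : LinearMap.BilinForm ℝ V} {N N' : V → V → V}
    (hN : IsLeviCivitaProduct ip N) (hN' : IsLeviCivitaProduct ip N')
    (hs : ∀ a b, ip a b = ip b a) (hp : ∀ a, a ≠ 0 → 0 < ip a a) (a b : V) :
    N a b = N' a b :=
  eq_of_forall_inner_eq hp fun c => by linarith [hN.koszul hs a b c, hN'.koszul hs a b c]

theorem nondegenerate_of_pos {ip : LinearMap.BilinForm ℝ V}
    (hp : ∀ a, a ≠ 0 → 0 < ip a a) : ip.Nondegenerate := by
  constructor
  · intro a ha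
    by_contra h
    exact (hp a h).ne' (ha a)
  · intro a ha
    by_contra h
    exact (hp a h).ne' (ha a)

/-- Koszul's formula prescribes a functional of `c`, which nondegeneracy represents by a vector. -/
theorem exists_isLeviCivitaProduct [FiniteDimensional ℝ V] {ip : LinearMap.BilinForm ℝ V}
    (hs : ∀ a b, ip a b = ip b a) (hp : ∀ a, a ≠ 0 → 0 < ip a a) :
    ∃ N : V →ₗ[ℝ] V →ₗ[ℝ] V, IsLeviCivitaProduct ip (fun a b => N a b) := by
  have hnd := nondegenerate_of_pos hp
  let K : V → V → Module.Dual ℝ V := fun a b =>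
    { toFun := fun c => (1 / 2 : ℝ) * (ip ⁅a, b⁆ c - ip ⁅b, c⁆ a + ip ⁅c, a⁆ b)
      map_add' := fun c d => by
        simp only [lie_add, add_lie, map_add, LinearMap.add_apply]; ring
      map_smul' := fun r c => by
        simp only [lie_smul, smul_lie, map_smul, LinearMap.smul_apply, smul_eq_mul,
          RingHom.id_apply]; ring }
  have hK : ∀ a b c, ip ((ip.toDual hnd).symm (K a b)) c
      = (1 / 2 : ℝ) * (ip ⁅a, b⁆ c - ip ⁅b, c⁆ a + ip ⁅c, a⁆ b) := fun a b c => by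
    rw [LinearMap.BilinForm.apply_toDual_symm_apply]; rfl
  refine ⟨LinearMap.mk₂ ℝ (fun a b => (ip.toDual hnd).symm (K a b)) ?_ ?_ ?_ ?_, ?_, ?_⟩
  · intro a a' b
    refine eq_of_forall_inner_eq hp fun c => ?_
    simp only [map_add, LinearMap.add_apply, hK, add_lie, lie_add]; ring
  · intro r a b
    refine eq_of_forall_inner_eq hp fun c => ?_
    simp only [map_smul, LinearMap.smul_apply, hK, smul_lie, lie_smul, smul_eq_mul]; ring
  · intro a b b'
    refine eq_of_forall_inner_eq hp fun c => ?_
    simp only [map_add, LinearMap.add_apply, hK, add_lie, lie_add]; ring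
  · intro r a b
    refine eq_of_forall_inner_eq hp fun c => ?_
    simp only [map_smul, LinearMap.smul_apply, hK, smul_lie, lie_smul, smul_eq_mul]; ring
  · intro a b
    refine eq_of_forall_inner_eq hp fun c => ?_
    simp only [LinearMap.mk₂_apply, map_sub, LinearMap.sub_apply, hK]
    rw [← lie_skew a b, ← lie_skew c b, ← lie_skew a c]
    simp only [map_neg, LinearMap.neg_apply]
    ring
  · intro a b c
    simp only [LinearMap.mk₂_apply, hs b, hK]
    rw [← lie_skew a b, ← lie_skew c b, ← lie_skew a c]
    simp only [map_neg, LinearMap.neg_apply]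
    ring

/-- The curvature expression of the inner product `ip (Φ ·) ·` on the plane spanned by `Φ⁻¹ X`
and `Φ⁻¹ Y`, for commuting `X`, `Y` and an `ad`-invariant inner product `ip`, where
`Φ⁻¹ = 1 - t Ψ`. -/
theorem curvature_expansion {ip : LinearMap.BilinForm ℝ V}
    (hs : ∀ a b, ip a b = ip b a) (hp : ∀ a, a ≠ 0 → 0 < ip a a)
    (had : ∀ a b c : V, ip ⁅a, b⁆ c + ip b ⁅a, c⁆ = 0)
    {ip' : LinearMap.BilinForm ℝ V} (hs' : ∀ a b, ip' a b = ip' b a)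
    {t : ℝ} {Φ : V ≃ₗ[ℝ] V} (hΦ : ∀ a b, ip' a b = ip (Φ a) b)
    {Ψ : V →ₗ[ℝ] V} (hΨs : ∀ a b, ip (Ψ a) b = ip (Ψ b) a)
    (hΨ : ∀ a, Φ.symm a = a - t • Ψ a)
    {X Y : V} (hXY : ⁅X, Y⁆ = 0) {N : V → V → V} (hN : IsLeviCivitaProduct ip' N)
    {v w : V} (hv : v = ⁅X, Ψ Y⁆ + ⁅Ψ X, Y⁆) (hw : w = ⁅Ψ X, Ψ Y⁆)
    {x y : V} (hx : x = Φ.symm X) (hy : y = Φ.symm Y) :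
    ip' (N x (N y y) - N y (N x y) - N ⁅x, y⁆ y) x =
      t ^ 3 * (ip v w + ip ⁅Ψ X, X⁆ (Ψ ⁅Ψ Y, Y⁆) - ip ⁅X, Ψ Y⁆ (Ψ ⁅X, Ψ Y⁆)
          - ip ⁅X, Ψ Y⁆ (Ψ ⁅Ψ X, Y⁆) - ip ⁅Ψ X, Y⁆ (Ψ ⁅Ψ X, Y⁆)
        + t * (-(3 / 4) * (ip w w - 2 * ip (Ψ v) w + t * ip (Ψ w) w + ip (Φ (Ψ (Ψ v))) v
          - t * (ip (Φ (Ψ (Ψ v))) w + ip (Φ (Ψ (Ψ w))) v) + t ^ 2 * ip (Φ (Ψ (Ψ w))) w))) := by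
  have hΦx : Φ x = X := by simp [hx]
  have hΦy : Φ y = Y := by simp [hy]
  rw [hΨ] at hx hy
  set p := ⁅X, Ψ Y⁆ with hpdef
  set q := ⁅Ψ X, Y⁆ with hqdef
  have hq' : ⁅Y, Ψ X⁆ = -q := (lie_skew Y (Ψ X)).symm
  have had' : ∀ a b c : V, ip ⁅a, b⁆ c = ip a ⁅b, c⁆ := fun a b c => by
    rw [← lie_skew, map_neg, LinearMap.neg_apply]
    linarith [had b a c]
  -- Ad-invariance moves every bracket off `c`, so Koszul's formula becomes a formula for Φ(N a b)
  -- itself.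
  have hprod : ∀ a b c, 2 * ip (Φ (N a b)) c = ip (Φ ⁅a, b⁆ + ⁅a, Φ b⁆ - ⁅Φ a, b⁆) c := by
    intro a b c
    have h := hN.koszul hs' a b c
    rw [hΦ, hΦ, hs' _ a, hs' _ b, hΦ, hΦ, ← had', ← lie_skew c a, map_neg] at h
    rw [h]
    have := had a (Φ b) c
    simp only [map_add, map_sub, LinearMap.add_apply, LinearMap.sub_apply]
    linarith
  have hxy : ⁅x, y⁆ = -(t • v) + t ^ 2 • w := by
    rw [hx, hy, hv, hw]
    simp only [sub_lie, lie_sub, smul_lie, lie_smul, hXY, ← hpdef, ← hqdef]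
    module
  have hxY : ⁅x, Y⁆ = -(t • q) := by
    rw [hx]; simp only [sub_lie, smul_lie, hXY, ← hqdef]; module
  have hXy : ⁅X, y⁆ = -(t • p) := by
    rw [hy]; simp only [lie_sub, lie_smul, hXY, ← hpdef]; module
  have hNe : ∀ {n m : V}, (∀ c, ip (Φ n) c = ip m c) → n = m - t • Ψ m := fun {n m} h => by
    rw [← hΨ, LinearEquiv.eq_symm_apply]; exact eq_of_forall_inner_eq hp h
  -- Here Φ(N a a) = [a, Φa] = [a, A], which is of order t because a = A - tΨA and [A, A] = 0.
  have hself : ∀ a A, Φ a = A → a = A - t • Ψ A → N a a = -(t • ⁅Ψ A, A⁆) - t • Ψ (-(t • ⁅Ψ A, A⁆)) := by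
    intro a A h1 h2
    refine hNe fun c => ?_
    have h3 : 2 * ip (Φ (N a a)) c = 2 * ip ⁅a, Φ a⁆ c := by
      rw [hprod, lie_self, map_zero, ← lie_skew (Φ a) a, zero_add, sub_neg_eq_add, map_add,
        LinearMap.add_apply, two_mul]
    have h4 : ⁅a, A⁆ = -(t • ⁅Ψ A, A⁆) := by
      rw [h2, sub_lie, lie_self, smul_lie, zero_sub]
    rw [h1, h4] at h3
    linarith
  have hNxx := hself x X hΦx hx
  have hNyy := hself y Y hΦy hy
  set z := ⁅x, y⁆ with hz
  -- the symmetric part of `N x y`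
  set s := (t / 2) • (p - q) - t • Ψ ((t / 2) • (p - q)) with hsdef
  have hΦs : Φ s = (t / 2) • (p - q) := by rw [hsdef, ← hΨ, LinearEquiv.apply_symm_apply]
  have hNxy : N x y = (1 / 2 : ℝ) • z + s := by
    apply Φ.injective
    refine eq_of_forall_inner_eq hp fun c => ?_
    have := hprod x y c
    rw [hΦx, hΦy, hxY, hXy] at this
    rw [map_add, hΦs, map_smul]
    simp only [map_add, map_sub, map_smul, map_neg, LinearMap.add_apply, LinearMap.sub_apply,
      LinearMap.smul_apply, LinearMap.neg_apply, smul_eq_mul] at this ⊢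
    linarith
  have hNyx : N y x = -((1 / 2 : ℝ) • z) + s := by
    have := hN.torsion_eq_zero x y
    rw [hNxy] at this
    rw [sub_eq_iff_eq_add, ← hz] at this
    have h2 : N y x = ((1 / 2 : ℝ) • z + s) - z := by rw [this]; abel
    rw [h2]; module
  -- Skewness of `N x` and `N y` removes the nested products.
  have hcurv : ip' (N x (N y y) - N y (N x y) - N z y) x
      = -ip' (N y y) (N x x) + ip' (N x y) (N y x) - ip' (N z y) x := by
    simp only [map_sub, LinearMap.sub_apply]
    linarith [hN.skew x (N y y) x, hN.skew y (N x y) x]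
  have hthird : 2 * ip' (N z y) x = -ip z (⁅X, y⁆ + ⁅x, Y⁆) + ip (Φ z) z := by
    have h := hprod z y x
    rw [hΦ, h, hΦy]
    simp only [map_add, map_sub, LinearMap.add_apply, LinearMap.sub_apply]
    have e1 : ip (Φ ⁅z, y⁆) x = -ip z ⁅X, y⁆ := by
      rw [← hΦ, hs', hΦ, hΦx, hs, had', ← lie_skew y X, map_neg]
    have e2 : ip ⁅z, Y⁆ x = -ip z ⁅x, Y⁆ := by rw [had', ← lie_skew Y x, map_neg]
    have e3 : ip ⁅Φ z, y⁆ x = -ip (Φ z) z := by rw [had', ← lie_skew y x, map_neg]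
    rw [e1, e2, e3]; ring
  -- This identity, from Jacobi and [X,Y] = 0, is what kills the t² coefficient of the curvature.
  have hjac : ip ⁅Ψ X, X⁆ ⁅Ψ Y, Y⁆ = -ip p q := by
    have h1 : ⁅X, ⁅Ψ Y, Y⁆⁆ = ⁅p, Y⁆ := by rw [leibniz_lie, hXY, lie_zero, add_zero]
    rw [had', h1, hs, had', hq', map_neg]
  -- Applying Φ(1 - tΨ) = 1 twice gives Φ = 1 + tΨ + t²ΦΨ², an exact identity that needs no power
  -- series.
  have hΦrec : ∀ a, Φ a = a + t • Φ (Ψ a) := fun a => by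
    have h := Φ.apply_symm_apply a
    rw [hΨ, map_sub, map_smul] at h
    exact sub_eq_iff_eq_add.1 h
  have hΦz : Φ z = z + t • Ψ z + t ^ 2 • Φ (Ψ (Ψ z)) := by
    conv_lhs => rw [hΦrec, hΦrec (Ψ z)]
    module
  have hzz : ip (Φ z) z = t ^ 2 * (ip v v - 2 * t * ip v w + t ^ 2 * ip w w
      + t * (ip (Ψ v) v - 2 * t * ip (Ψ v) w + t ^ 2 * ip (Ψ w) w)
      + t ^ 2 * (ip (Φ (Ψ (Ψ v))) v
          - t * (ip (Φ (Ψ (Ψ v))) w + ip (Φ (Ψ (Ψ w))) v) + t ^ 2 * ip (Φ (Ψ (Ψ w))) w)) := by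
    rw [hΦz, hxy]
    simp only [map_add, map_smul, map_neg, LinearMap.add_apply,
      LinearMap.smul_apply, LinearMap.neg_apply, smul_eq_mul]
    linear_combination (-t^3) * hs w v - t^4 * hΨs w v
  have hmid : ip' (N x y) (N y x) = -(1 / 4) * ip (Φ z) z
      + t ^ 2 / 4 * (ip (p - q) (p - q) - t * ip (p - q) (Ψ (p - q))) := by
    have h1 : ip' z s = ip' s z := hs' _ _
    have h2 : ip' s s = t ^ 2 / 4 * (ip (p - q) (p - q) - t * ip (p - q) (Ψ (p - q))) := by
      rw [hΦ, hΦs, hsdef]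
      simp only [map_sub, map_smul, LinearMap.sub_apply, LinearMap.smul_apply, smul_eq_mul]
      ring
    rw [hNxy, hNyx, ← h2, ← hΦ]
    simp only [map_add, map_smul, map_neg, LinearMap.add_apply, LinearMap.smul_apply, smul_eq_mul]
    linear_combination (1/2) * h1
  have hfirst : ip' (N y y) (N x x) = t ^ 2 * (ip ⁅Ψ X, X⁆ ⁅Ψ Y, Y⁆
      - t * ip ⁅Ψ X, X⁆ (Ψ ⁅Ψ Y, Y⁆)) := by
    have h1 : Φ (N y y) = -(t • ⁅Ψ Y, Y⁆) := by
      rw [hNyy, ← hΨ, LinearEquiv.apply_symm_apply]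
    rw [hΦ, h1, hNxx]
    simp only [map_sub, map_smul, map_neg, LinearMap.smul_apply, LinearMap.neg_apply, smul_eq_mul]
    linear_combination t ^ 2 * hs ⁅Ψ Y, Y⁆ ⁅Ψ X, X⁆ - t^3 * hs ⁅Ψ Y, Y⁆ (Ψ ⁅Ψ X, X⁆)
      - t^3 * hΨs ⁅Ψ X, X⁆ ⁅Ψ Y, Y⁆ - t^3 * hs (Ψ ⁅Ψ Y, Y⁆) ⁅Ψ X, X⁆
  have hlin : ip z (⁅X, y⁆ + ⁅x, Y⁆) = t ^ 2 * (ip v v - t * ip v w) := by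
    have : ⁅X, y⁆ + ⁅x, Y⁆ = -(t • v) := by rw [hXy, hxY, hv]; module
    rw [this, hxy]
    simp only [map_add, map_smul, map_neg, LinearMap.add_apply, LinearMap.smul_apply,
      LinearMap.neg_apply, smul_eq_mul]
    linear_combination (-t^3) * hs w v
  have hsq : ip v v = ip p p + 2 * ip p q + ip q q := by
    rw [hv]; simp only [map_add, LinearMap.add_apply]; linear_combination hs q p
  have hsq' : ip (p - q) (p - q) = ip p p - 2 * ip p q + ip q q := by
    simp only [map_sub, LinearMap.sub_apply]; linear_combination -hs q p
  have hpq : ip q (Ψ p) = ip p (Ψ q) := by rw [hs, hΨs, hs]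
  have hψv : ip (Ψ v) v = ip p (Ψ p) + 2 * ip p (Ψ q) + ip q (Ψ q) := by
    rw [hs, hv]; simp only [map_add, LinearMap.add_apply]; linear_combination hpq
  have hψs : ip (p - q) (Ψ (p - q)) = ip p (Ψ p) - 2 * ip p (Ψ q) + ip q (Ψ q) := by
    simp only [map_sub, LinearMap.sub_apply]; linear_combination -hpq
  rw [hcurv, hfirst, hmid]
  have h3 : ip' (N z y) x = (1 / 2) * (-ip z (⁅X, y⁆ + ⁅x, Y⁆) + ip (Φ z) z) := by
    linarith
  -- The form ⟨Φz,z⟩ enters with -1/4 from `hmid` and -1/2 from `h3`: hence the -3/4 in the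
  -- remainder.
  rw [h3, hlin, hzz, hjac, hsq', hψs, hψv, hsq]
  ring

end Algebra

/-! ### Left-invariant metrics -/

section Translations

variable {E : Type*} [NormedAddCommGroup E] [NormedSpace ℝ E]

theorem finiteDimensional_tangentSpace [FiniteDimensional ℝ E]
    {M : Type*} [TopologicalSpace M] [ChartedSpace E M] (y : M) :
    FiniteDimensional ℝ (TangentSpace 𝓘(ℝ, E) y) :=
  inferInstanceAs (FiniteDimensional ℝ E)

variable {G : Type*} [TopologicalSpace G] [ChartedSpace E G] [Group G]

theorem mulInvariantVectorField_sub_apply (a b : GroupLieAlgebra 𝓘(ℝ, E) G) (y : G) :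
    mulInvariantVectorField (a - b) y
      = mulInvariantVectorField a y - mulInvariantVectorField b y :=
  map_sub (mfderiv 𝓘(ℝ, E) 𝓘(ℝ, E) (fun x : G => y * x) 1) a b

theorem mulInvariantVectorField_sum_apply {ι : Type*} (s : Finset ι)
    (a : ι → GroupLieAlgebra 𝓘(ℝ, E) G) (y : G) :
    mulInvariantVectorField (∑ i ∈ s, a i) y = ∑ i ∈ s, mulInvariantVectorField (a i) y :=
  map_sum (mfderiv 𝓘(ℝ, E) 𝓘(ℝ, E) (fun x : G => y * x) 1) a s

theorem mulInvariantVectorField_smul_apply (r : ℝ) (a : GroupLieAlgebra 𝓘(ℝ, E) G) (y : G) :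
    mulInvariantVectorField (r • a) y = r • mulInvariantVectorField a y :=
  map_smul (mfderiv 𝓘(ℝ, E) 𝓘(ℝ, E) (fun x : G => y * x) 1) r a

theorem mulInvariantVectorField_one (a : GroupLieAlgebra 𝓘(ℝ, E) G) :
    mulInvariantVectorField a (1 : G) = a := by
  have h : (fun x : G => (1 : G) * x) = id := by ext x; simp
  have h2 : ∀ f : G → G, f = id → ∀ v : E,
      (mfderiv 𝓘(ℝ, E) 𝓘(ℝ, E) f (1 : G) : E → E) v = v := by
    rintro _ rfl v
    rw [mfderiv_id]; rfl
  exact h2 _ h a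

end Translations

section LeftInvariant

variable {E : Type*} [NormedAddCommGroup E] [NormedSpace ℝ E]
  {G : Type*} [TopologicalSpace G] [ChartedSpace E G] [Group G] [LieGroup 𝓘(ℝ, E) ∞ G]

/-- The regularity at which the bracket on `GroupLieAlgebra` is a Lie algebra structure; over ℝ it
is just 3. -/
theorem lieGroup_minSmoothness : LieGroup 𝓘(ℝ, E) (minSmoothness ℝ 3) G := by
  rw [minSmoothness_of_isRCLikeNormedField]
  infer_instance

attribute [local instance] lieGroup_minSmoothness

/-- The inner product on the Lie algebra given by a metric on the group. -/
def metricForm (g : Metric E G) : LinearMap.BilinForm ℝ (GroupLieAlgebra 𝓘(ℝ, E) G) :=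
  LinearMap.mk₂ ℝ (fun a b => g.inner 1 a b) (fun a a' b => by simp) (fun r a b => by simp)
    (fun a b b' => by simp) (fun r a b => by simp)

theorem metricForm_apply (g : Metric E G) (a b : GroupLieAlgebra 𝓘(ℝ, E) G) :
    metricForm g a b = g.inner 1 a b := rfl

theorem metricForm_symm (g : Metric E G) (a b : GroupLieAlgebra 𝓘(ℝ, E) G) :
    metricForm g a b = metricForm g b a := g.symm 1 a b

theorem metricForm_pos (g : Metric E G) (a : GroupLieAlgebra 𝓘(ℝ, E) G) (ha : a ≠ 0) :
    0 < metricForm g a a := g.pos 1 a ha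

/-- Transports an inner product along `y * 1 = y` or `1 * y = y`, where the two tangent spaces
differ as types. -/
theorem inner_congr_point (g : Metric E G) {y z : G} (h : z = y) (v w : E) :
    g.inner z (show TangentSpace 𝓘(ℝ, E) z from v) (show TangentSpace 𝓘(ℝ, E) z from w)
      = g.inner y (show TangentSpace 𝓘(ℝ, E) y from v) (show TangentSpace 𝓘(ℝ, E) y from w) := by
  subst h; rfl

theorem IsLeftInvariant.inner_mulInvariantVectorField {g : Metric E G} (hg : IsLeftInvariant g)
    (a b : GroupLieAlgebra 𝓘(ℝ, E) G) (y : G) :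
    g.inner y (mulInvariantVectorField a y) (mulInvariantVectorField b y) = metricForm g a b :=
  (inner_congr_point g (mul_one y) _ _).symm.trans (hg y 1 a b)

attribute [local instance] finiteDimensional_tangentSpace

/-- Left translation preserves a positive definite form, hence is injective on tangent vectors;
equality of dimensions gives the rest. -/
theorem mulInvariantVectorField_bijective [FiniteDimensional ℝ E] {g : Metric E G}
    (hg : IsLeftInvariant g) (y : G) :
    Function.Bijective
      (mfderiv 𝓘(ℝ, E) 𝓘(ℝ, E) (fun x : G => y * x) 1 : _ →L[ℝ] _).toLinearMap := by
  have hinj : Function.Injective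
      (mfderiv 𝓘(ℝ, E) 𝓘(ℝ, E) (fun x : G => y * x) 1 : _ →L[ℝ] _).toLinearMap := by
    rw [← LinearMap.ker_eq_bot, LinearMap.ker_eq_bot']
    intro a ha
    by_contra hne
    have h1 := metricForm_pos g a hne
    have h2 : mulInvariantVectorField a y = 0 := ha
    rw [← hg.inner_mulInvariantVectorField a a y, h2, map_zero] at h1
    exact lt_irrefl _ h1
  exact ⟨hinj, (LinearMap.injective_iff_surjective_of_finrank_eq_finrank rfl).1 hinj⟩

theorem exists_mulInvariantVectorField_eq [FiniteDimensional ℝ E] {g : Metric E G}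
    (hg : IsLeftInvariant g) (y : G) (v : TangentSpace 𝓘(ℝ, E) y) :
    ∃ a : GroupLieAlgebra 𝓘(ℝ, E) G, mulInvariantVectorField a y = v :=
  (mulInvariantVectorField_bijective hg y).2 v

theorem mdiffAt_mulInvariantVectorField (a : GroupLieAlgebra 𝓘(ℝ, E) G) (x : G) :
    MDiffAt (T% (mulInvariantVectorField a : Π y : G, TangentSpace 𝓘(ℝ, E) y)) x :=
  mdifferentiableAt_mulInvariantVectorField a

theorem mlieBracket_mulInvariantVectorField [FiniteDimensional ℝ E]
    (a b : GroupLieAlgebra 𝓘(ℝ, E) G) (y : G) :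
    mlieBracket 𝓘(ℝ, E) (mulInvariantVectorField a) (mulInvariantVectorField b) y
      = mulInvariantVectorField ⁅a, b⁆ y := by
  rw [GroupLieAlgebra.bracket_def, mulInvariantVector_mlieBracket]

section LeviCivita

variable [FiniteDimensional ℝ E]

theorem IsLeviCivita.sub_eq_mlieBracket {g : Metric E G} {D : Connection E G}
    (hD : IsLeviCivita g D) {X Y : Π y : G, TangentSpace 𝓘(ℝ, E) y} {x : G}
    (hX : MDiffAt (T% X) x) (hY : MDiffAt (T% Y) x) :
    D Y x (X x) - D X x (Y x) = mlieBracket 𝓘(ℝ, E) X Y x :=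
  D.torsion_eq_zero_iff.1 hD.torsion_eq_zero hX hY

theorem IsLeviCivita.inner_add_inner_eq_zero {g : Metric E G}
    {D : Connection E G} (hD : IsLeviCivita g D) {x : G} (v : TangentSpace 𝓘(ℝ, E) x)
    {Y Z : Π y : G, TangentSpace 𝓘(ℝ, E) y} (hY : MDiffAt (T% Y) x) (hZ : MDiffAt (T% Z) x)
    {c : ℝ} (hc : ∀ y, g.inner y (Y y) (Z y) = c) :
    g.inner x (D Y x v) (Z x) + g.inner x (Y x) (D Z x v) = 0 := by
  rw [← hD.compatible x v Y Z hY hZ]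
  have h : ∀ f : G → ℝ, f = (fun _ => c) →
      (mfderiv 𝓘(ℝ, E) 𝓘(ℝ, ℝ) f x : E → ℝ) v = 0 := by
    rintro _ rfl
    rw [mfderiv_const]; rfl
  exact h _ (funext hc)

/-- The covariant derivatives of left-invariant fields are given by the Levi-Civita product. -/
theorem IsLeviCivita.apply_mulInvariantVectorField {g : Metric E G} (hg : IsLeftInvariant g)
    {D : Connection E G} (hD : IsLeviCivita g D)
    {N : GroupLieAlgebra 𝓘(ℝ, E) G → GroupLieAlgebra 𝓘(ℝ, E) G → GroupLieAlgebra 𝓘(ℝ, E) G}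
    (hN : IsLeviCivitaProduct (metricForm g) N) (a b : GroupLieAlgebra 𝓘(ℝ, E) G) (y : G) :
    D (mulInvariantVectorField b) y (mulInvariantVectorField a y)
      = mulInvariantVectorField (N a b) y := by
  -- The connection at the fixed point `y`, pulled back to the Lie algebra, is a Levi-Civita product
  -- for the same form, so uniqueness identifies it with `N`.
  choose N' hN' using fun a b => exists_mulInvariantVectorField_eq hg y
    (D (mulInvariantVectorField b) y (mulInvariantVectorField a y))
  rw [← hN']
  congr 1
  refine IsLeviCivitaProduct.unique (ip := metricForm g) (N := N') ⟨?_, ?_⟩ hN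
    (metricForm_symm g) (metricForm_pos g) a b
  · intro a b
    apply (mulInvariantVectorField_bijective hg y).1
    change mulInvariantVectorField (N' a b - N' b a) y = mulInvariantVectorField ⁅a, b⁆ y
    rw [mulInvariantVectorField_sub_apply, hN', hN', ← mlieBracket_mulInvariantVectorField]
    exact hD.sub_eq_mlieBracket (mdiffAt_mulInvariantVectorField a y)
      (mdiffAt_mulInvariantVectorField b y)
  · intro a b c
    rw [← hg.inner_mulInvariantVectorField _ _ y, ← hg.inner_mulInvariantVectorField _ _ y,
      hN', hN']
    exact hD.inner_add_inner_eq_zero _ (mdiffAt_mulInvariantVectorField b y)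
      (mdiffAt_mulInvariantVectorField c y) fun z => hg.inner_mulInvariantVectorField b c z

theorem IsLeviCivita.curvature_mulInvariantVectorField {g : Metric E G} (hg : IsLeftInvariant g)
    {D : Connection E G} (hD : IsLeviCivita g D)
    {N : GroupLieAlgebra 𝓘(ℝ, E) G → GroupLieAlgebra 𝓘(ℝ, E) G → GroupLieAlgebra 𝓘(ℝ, E) G}
    (hN : IsLeviCivitaProduct (metricForm g) N) (a b c : GroupLieAlgebra 𝓘(ℝ, E) G) :
    curvature D (mulInvariantVectorField a) (mulInvariantVectorField b)
      (mulInvariantVectorField c) (1 : G) = N a (N b c) - N b (N a c) - N ⁅a, b⁆ c := by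
  have h : ∀ b c, (fun y => D (mulInvariantVectorField c) y (mulInvariantVectorField b y))
      = mulInvariantVectorField (N b c) := fun b c =>
    funext fun y => hD.apply_mulInvariantVectorField hg hN b c y
  rw [curvature, h, h, mlieBracket_mulInvariantVectorField,
    hD.apply_mulInvariantVectorField hg hN, hD.apply_mulInvariantVectorField hg hN,
    hD.apply_mulInvariantVectorField hg hN]
  simp only [mulInvariantVectorField_one]

theorem lieSectionalCurvature_eq {g : Metric E G} (hg : IsLeftInvariant g)
    (hex : ∃ D : Connection E G, IsLeviCivita g D)
    {N : GroupLieAlgebra 𝓘(ℝ, E) G → GroupLieAlgebra 𝓘(ℝ, E) G → GroupLieAlgebra 𝓘(ℝ, E) G}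
    (hN : IsLeviCivitaProduct (metricForm g) N) (a b : GroupLieAlgebra 𝓘(ℝ, E) G) :
    lieSectionalCurvature g a b
      = metricForm g (N a (N b b) - N b (N a b) - N ⁅a, b⁆ b) a := by
  rw [lieSectionalCurvature, sectionalCurvature, dif_pos hex,
    hex.choose_spec.curvature_mulInvariantVectorField hg hN, mulInvariantVectorField_one]
  rfl

end LeviCivita

end LeftInvariant

/-! ### Existence of the Levi-Civita connection of a left-invariant metric -/

/-! ### Tensoriality of the failure of metric compatibility. -/

section Compatibility

variable {E : Type*} [NormedAddCommGroup E] [NormedSpace ℝ E]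
  {M : Type*} [TopologicalSpace M] [ChartedSpace E M] [IsManifold 𝓘(ℝ, E) ∞ M]

theorem mdiffAt_inner (g : Metric E M) {Y Z : Π y : M, TangentSpace 𝓘(ℝ, E) y} {x : M}
    (hY : MDiffAt (T% Y) x) (hZ : MDiffAt (T% Z) x) :
    MDiffAt (fun y => g.inner y (Y y) (Z y)) x := by
  have : MDifferentiableAt 𝓘(ℝ, E) (𝓘(ℝ, E).prod 𝓘(ℝ))
      (fun m ↦ TotalSpace.mk' ℝ (E := Bundle.Trivial M ℝ) m (g.inner m (Y m) (Z m))) x := by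
    apply MDifferentiableAt.clm_bundle_apply₂ (F₁ := E) (F₂ := E)
    · exact g.contMDiff.mdifferentiableAt (by simp)
    · exact hY
    · exact hZ
  simp only [mdifferentiableAt_totalSpace] at this
  exact this.2

/-- The failure of the connection `D` to be compatible with the metric `g`. -/
def metricDefect (g : Metric E M) (D : Connection E M) {x : M} (v : TangentSpace 𝓘(ℝ, E) x)
    (Y Z : Π y : M, TangentSpace 𝓘(ℝ, E) y) : ℝ :=
  mvfderiv 𝓘(ℝ, E) (fun y => g.inner y (Y y) (Z y)) x v
    - g.inner x (D Y x v) (Z x) - g.inner x (Y x) (D Z x v)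

theorem metricDefect_comm (g : Metric E M) (D : Connection E M) {x : M}
    (v : TangentSpace 𝓘(ℝ, E) x) (Y Z : Π y : M, TangentSpace 𝓘(ℝ, E) y) :
    metricDefect g D v Y Z = metricDefect g D v Z Y := by
  simp only [metricDefect, g.symm _ (Y _), g.symm _ (D Y _ _)]
  ring

/-- The derivative of the scalar factor appears once from the product rule and once from the Leibniz
rule for `D`, with opposite signs. -/
theorem tensorialAt_metricDefect (g : Metric E M) (D : Connection E M) {x : M}
    (v : TangentSpace 𝓘(ℝ, E) x) {Z : Π y : M, TangentSpace 𝓘(ℝ, E) y} (hZ : MDiffAt (T% Z) x) :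
    TensorialAt 𝓘(ℝ, E) E (fun Y => metricDefect g D v Y Z) x where
  smul {f σ} hf hσ := by
    have h : (fun y => g.inner y ((f • σ) y) (Z y)) = f * fun y => g.inner y (σ y) (Z y) := by
      ext y
      change g.inner y (f y • σ y) (Z y) = f y * g.inner y (σ y) (Z y)
      rw [map_smul]; rfl
    simp only [metricDefect]
    rw [h, mvfderiv_mul hf (mdiffAt_inner g hσ hZ),
      D.isCovariantDerivativeOnUniv.leibniz hσ hf]
    simp only [_root_.add_apply, _root_.smul_apply, smul_eq_mul,
      map_add, map_smul, ContinuousLinearMap.smulRight_apply, Pi.smul_apply']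
    ring
  add {σ σ'} hσ hσ' := by
    have h : (fun y => g.inner y ((σ + σ') y) (Z y))
        = (fun y => g.inner y (σ y) (Z y)) + fun y => g.inner y (σ' y) (Z y) := by
      ext y
      simp
    simp only [metricDefect]
    rw [h, mvfderiv_add (mdiffAt_inner g hσ hZ) (mdiffAt_inner g hσ' hZ),
      D.isCovariantDerivativeOnUniv.add hσ hσ']
    simp only [_root_.add_apply, map_add, Pi.add_apply]
    ring

theorem metricDefect_congr [FiniteDimensional ℝ E] (g : Metric E M) (D : Connection E M) {x : M}
    (v : TangentSpace 𝓘(ℝ, E) x) {Y Y' Z Z' : Π y : M, TangentSpace 𝓘(ℝ, E) y}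
    (hY : MDiffAt (T% Y) x) (hY' : MDiffAt (T% Y') x) (hZ : MDiffAt (T% Z) x)
    (hZ' : MDiffAt (T% Z') x) (hYY' : Y x = Y' x) (hZZ' : Z x = Z' x) :
    metricDefect g D v Y Z = metricDefect g D v Y' Z' := by
  refine TensorialAt.pointwise₂ (fun τ hτ => tensorialAt_metricDefect g D v hτ)
    (fun σ hσ => ?_) hY hY' hZ hZ' hYY' hZZ'
  simp only [metricDefect_comm g D v σ]
  exact tensorialAt_metricDefect g D v hσ

end Compatibility

/-! ### Levi-Civita connection as flat connection plus an invariant tensor. -/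

section Existence

variable {E : Type*} [NormedAddCommGroup E] [NormedSpace ℝ E] [FiniteDimensional ℝ E]
  {G : Type*} [TopologicalSpace G] [ChartedSpace E G] [Group G] [LieGroup 𝓘(ℝ, E) ∞ G]

attribute [local instance] lieGroup_minSmoothness finiteDimensional_tangentSpace

variable {ι : Type*} [Fintype ι] {g : Metric E G} {b d : ι → GroupLieAlgebra 𝓘(ℝ, E) G}

theorem sum_inner_smul_mulInvariantVectorField (hg : IsLeftInvariant g)
    (hbd : ∀ a, ∑ i, metricForm g (d i) a • b i = a) (x : G) (v : TangentSpace 𝓘(ℝ, E) x) :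
    ∑ i, g.inner x (mulInvariantVectorField (d i) x) v • mulInvariantVectorField (b i) x = v := by
  obtain ⟨a, rfl⟩ := exists_mulInvariantVectorField_eq hg x v
  simp only [hg.inner_mulInvariantVectorField, ← mulInvariantVectorField_smul_apply]
  rw [← mulInvariantVectorField_sum_apply, hbd]

/-- The flat connection on a Lie group for which left-invariant vector fields are parallel, in
terms of a basis `b` of the Lie algebra and its dual basis `d` with respect to `g`. -/
def flatConnection (hg : IsLeftInvariant g)
    (hbd : ∀ a, ∑ i, metricForm g (d i) a • b i = a) : Connection E G where
  toFun Y x := ∑ i, (mvfderiv 𝓘(ℝ, E)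
    (fun y => g.inner y (mulInvariantVectorField (d i) y) (Y y)) x).smulRight
      (mulInvariantVectorField (b i) x)
  isCovariantDerivativeOnUniv :=
    { add := fun {σ σ' x} hσ hσ' _ => by
        rw [← Finset.sum_add_distrib]
        refine Finset.sum_congr rfl fun i _ => ?_
        have h : (fun y => g.inner y (mulInvariantVectorField (d i) y) ((σ + σ') y))
            = (fun y => g.inner y (mulInvariantVectorField (d i) y) (σ y))
              + fun y => g.inner y (mulInvariantVectorField (d i) y) (σ' y) := by
          ext y
          simp
        have hd := mdiffAt_mulInvariantVectorField (d i) x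
        rw [h, mvfderiv_add (mdiffAt_inner g hd hσ) (mdiffAt_inner g hd hσ')]
        ext v
        simp [add_smul]
      leibniz := fun {σ f x} hσ hf _ => by
        conv_rhs => rw [← sum_inner_smul_mulInvariantVectorField hg hbd x (σ x)]
        ext v
        simp only [_root_.add_apply, _root_.smul_apply,
          _root_.sum_apply, ContinuousLinearMap.smulRight_apply, Finset.smul_sum]
        rw [← Finset.sum_add_distrib]
        refine Finset.sum_congr rfl fun i _ => ?_
        have h : (fun y => g.inner y (mulInvariantVectorField (d i) y) ((f • σ) y))
            = f * fun y => g.inner y (mulInvariantVectorField (d i) y) (σ y) := by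
          ext y
          change g.inner y _ (f y • σ y) = f y * g.inner y _ (σ y)
          rw [map_smul]; rfl
        have hd := mdiffAt_mulInvariantVectorField (d i) x
        rw [h, mvfderiv_mul hf (mdiffAt_inner g hd hσ)]
        simp only [_root_.add_apply, _root_.smul_apply, smul_eq_mul]
        module }

theorem flatConnection_mulInvariantVectorField (hg : IsLeftInvariant g)
    (hbd : ∀ a, ∑ i, metricForm g (d i) a • b i = a) (a : GroupLieAlgebra 𝓘(ℝ, E) G) (x : G) :
    flatConnection hg hbd (mulInvariantVectorField a) x = 0 := by
  change ∑ i, (mvfderiv 𝓘(ℝ, E)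
    (fun y => g.inner y (mulInvariantVectorField (d i) y) (mulInvariantVectorField a y))
      x).smulRight (mulInvariantVectorField (b i) x) = 0
  refine Finset.sum_eq_zero fun i _ => ?_
  simp only [hg.inner_mulInvariantVectorField]
  rw [mvfderiv_const]
  ext v
  simp

/-- The connection on a Lie group whose restriction to left-invariant vector fields is given by
the bilinear product `N`. -/
def invariantConnection (hg : IsLeftInvariant g)
    (hbd : ∀ a, ∑ i, metricForm g (d i) a • b i = a)
    (N : GroupLieAlgebra 𝓘(ℝ, E) G →ₗ[ℝ] GroupLieAlgebra 𝓘(ℝ, E) G →ₗ[ℝ]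
      GroupLieAlgebra 𝓘(ℝ, E) G) : Connection E G :=
  (flatConnection hg hbd).addOneForm fun x => ∑ i, ∑ j,
    (g.inner x (mulInvariantVectorField (d j) x)).smulRight
      ((g.inner x (mulInvariantVectorField (d i) x)).smulRight
        (mulInvariantVectorField (N (b i) (b j)) x))

theorem invariantConnection_mulInvariantVectorField (hg : IsLeftInvariant g)
    (hbd : ∀ a, ∑ i, metricForm g (d i) a • b i = a)
    (N : GroupLieAlgebra 𝓘(ℝ, E) G →ₗ[ℝ] GroupLieAlgebra 𝓘(ℝ, E) G →ₗ[ℝ]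
      GroupLieAlgebra 𝓘(ℝ, E) G) (a c : GroupLieAlgebra 𝓘(ℝ, E) G) (x : G) :
    invariantConnection hg hbd N (mulInvariantVectorField c) x (mulInvariantVectorField a x)
      = mulInvariantVectorField (N a c) x := by
  change (flatConnection hg hbd (mulInvariantVectorField c) x + (∑ i, ∑ j,
    (g.inner x (mulInvariantVectorField (d j) x)).smulRight
      ((g.inner x (mulInvariantVectorField (d i) x)).smulRight
        (mulInvariantVectorField (N (b i) (b j)) x))) (mulInvariantVectorField c x))
      (mulInvariantVectorField a x) = _
  rw [flatConnection_mulInvariantVectorField, zero_add]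
  conv_rhs => rw [← hbd a, ← hbd c]
  simp only [map_sum, map_smul, LinearMap.sum_apply, LinearMap.smul_apply,
    _root_.sum_apply, ContinuousLinearMap.smulRight_apply,
    _root_.smul_apply, hg.inner_mulInvariantVectorField,
    mulInvariantVectorField_sum_apply, mulInvariantVectorField_smul_apply, Finset.smul_sum]
  rw [Finset.sum_comm]

/-- Torsion and metric defect depend only on pointwise values, and left-invariant fields span every
tangent space. It suffices to check both on such fields, where they reduce to the two axioms of `N`.
-/
theorem IsLeftInvariant.exists_isLeviCivita (hg : IsLeftInvariant g) :
    ∃ D : Connection E G, IsLeviCivita g D := by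
  obtain ⟨N, hN⟩ := exists_isLeviCivitaProduct (metricForm_symm g) (metricForm_pos g)
  have hnd := nondegenerate_of_pos (metricForm_pos g)
  let b := Module.finBasis ℝ (GroupLieAlgebra 𝓘(ℝ, E) G)
  let d := (metricForm g).dualBasis hnd b
  have hbd : ∀ a, ∑ i, metricForm g (d i) a • b i = a := fun a => by
    conv_rhs => rw [← b.sum_repr a]
    refine Finset.sum_congr rfl fun i _ => ?_
    -- Since the dual of the dual basis is `b`, this computes the `b`-coordinates of `a`.
    have h := LinearMap.BilinForm.dualBasis_repr_apply hnd d a i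
    rw [LinearMap.BilinForm.dualBasis_dualBasis hnd ⟨metricForm_symm g⟩ b,
      metricForm_symm] at h
    rw [h]
  refine ⟨invariantConnection hg hbd N, ?_, ?_⟩
  · ext x u v
    obtain ⟨a, rfl⟩ := exists_mulInvariantVectorField_eq hg x u
    obtain ⟨c, rfl⟩ := exists_mulInvariantVectorField_eq hg x v
    rw [CovariantDerivative.torsion_apply _ (mdiffAt_mulInvariantVectorField a x)
      (mdiffAt_mulInvariantVectorField c x), invariantConnection_mulInvariantVectorField,
      invariantConnection_mulInvariantVectorField, mlieBracket_mulInvariantVectorField,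
      ← hN.torsion_eq_zero, mulInvariantVectorField_sub_apply, sub_self]
    rfl
  · intro x v Y Z hY hZ
    obtain ⟨u, rfl⟩ := exists_mulInvariantVectorField_eq hg x v
    obtain ⟨a, ha⟩ := exists_mulInvariantVectorField_eq hg x (Y x)
    obtain ⟨c, hc⟩ := exists_mulInvariantVectorField_eq hg x (Z x)
    have h := metricDefect_congr g (invariantConnection hg hbd N) (mulInvariantVectorField u x)
      hY (mdiffAt_mulInvariantVectorField a x) hZ (mdiffAt_mulInvariantVectorField c x)
      ha.symm hc.symm
    have h0 : metricDefect g (invariantConnection hg hbd N) (mulInvariantVectorField u x)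
        (mulInvariantVectorField a) (mulInvariantVectorField c) = 0 := by
      simp only [metricDefect, invariantConnection_mulInvariantVectorField,
        hg.inner_mulInvariantVectorField]
      rw [mvfderiv_const, _root_.zero_apply]
      linarith [hN.skew u a c]
    rw [h0, metricDefect] at h
    exact sub_eq_zero.1 ((sub_sub _ _ _).symm.trans h)

end Existence

/-! ### Right-invariant vector fields commute with left-invariant ones -/

/-- With `F` a multiplication in a chart, `V` is left-invariant and `W` right-invariant. Both terms
of the bracket are the mixed second derivative of `F` at (e, e), so its symmetry makes them cancel.
Only the unit laws enter, not associativity. -/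
theorem lieBracket_partial_fderiv_eq_zero {E : Type*} [NormedAddCommGroup E] [NormedSpace ℝ E]
    {F : E × E → E} {e : E} (hF : ContDiffAt ℝ 2 F (e, e))
    (hl : ∀ᶠ v in 𝓝 e, F (e, v) = v) (hr : ∀ᶠ u in 𝓝 e, F (u, e) = u)
    {V W : E → E} {a b : E}
    (hV : V =ᶠ[𝓝 e] fun u => fderiv ℝ (fun v => F (u, v)) e a)
    (hW : W =ᶠ[𝓝 e] fun u => fderiv ℝ (fun v => F (v, u)) e b) :
    lieBracket ℝ V W e = 0 := by
  have hdiff : ∀ᶠ p in 𝓝 (e, e), DifferentiableAt ℝ F p :=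
    (hF.eventually (by simp)).mono fun p hp => hp.differentiableAt (by simp)
  have hd2 : HasFDerivAt (fderiv ℝ F) (fderiv ℝ (fderiv ℝ F) (e, e)) (e, e) :=
    ((hF.fderiv_right (m := 1) (by norm_num)).differentiableAt (by simp)).hasFDerivAt
  have hV' : V =ᶠ[𝓝 e] fun u => fderiv ℝ F (u, e) (0, a) := by
    have hc : Filter.Tendsto (fun u : E => (u, e)) (𝓝 e) (𝓝 (e, e)) :=
      (Continuous.prodMk_left e).tendsto e
    filter_upwards [hV, hc.eventually hdiff] with u hu hdu
    rw [hu]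
    have h1 : HasFDerivAt (fun v => F (u, v))
        ((fderiv ℝ F (u, e)).comp (ContinuousLinearMap.inr ℝ E E)) e :=
      HasFDerivAt.comp (g := F) e hdu.hasFDerivAt (hasFDerivAt_prodMk_right u e)
    rw [h1.fderiv]
    rfl
  have hW' : W =ᶠ[𝓝 e] fun u => fderiv ℝ F (e, u) (b, 0) := by
    have hc : Filter.Tendsto (fun u : E => (e, u)) (𝓝 e) (𝓝 (e, e)) :=
      (Continuous.prodMk_right e).tendsto e
    filter_upwards [hW, hc.eventually hdiff] with u hu hdu
    rw [hu]
    have h1 : HasFDerivAt (fun v => F (v, u))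
        ((fderiv ℝ F (e, u)).comp (ContinuousLinearMap.inl ℝ E E)) e :=
      HasFDerivAt.comp (g := F) e hdu.hasFDerivAt (hasFDerivAt_prodMk_left e u)
    rw [h1.fderiv]
    rfl
  have hVe : V e = a := by
    have h1 : (fun v => F (e, v)) =ᶠ[𝓝 e] fun v => v := hl
    refine hV.self_of_nhds.trans ?_
    simp only
    rw [h1.fderiv_eq]
    simp
  have hWe : W e = b := by
    have h1 : (fun v => F (v, e)) =ᶠ[𝓝 e] fun v => v := hr
    refine hW.self_of_nhds.trans ?_
    simp only
    rw [h1.fderiv_eq]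
    simp
  have hVd : ∀ c, fderiv ℝ V e c = fderiv ℝ (fderiv ℝ F) (e, e) (c, 0) (0, a) := fun c => by
    have h1 : HasFDerivAt (fun u => fderiv ℝ F (u, e) (0, a)) _ e :=
      (HasFDerivAt.comp (g := fderiv ℝ F) (f := fun u => (u, e)) e hd2
        (hasFDerivAt_prodMk_left e e)).clm_apply (hasFDerivAt_const (0, a) e)
    rw [hV'.fderiv_eq, h1.fderiv]
    simp
  have hWd : ∀ c, fderiv ℝ W e c = fderiv ℝ (fderiv ℝ F) (e, e) (0, c) (b, 0) := fun c => by
    have h1 : HasFDerivAt (fun u => fderiv ℝ F (e, u) (b, 0)) _ e :=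
      (HasFDerivAt.comp (g := fderiv ℝ F) (f := fun u => (e, u)) e hd2
        (hasFDerivAt_prodMk_right e e)).clm_apply (hasFDerivAt_const (b, 0) e)
    rw [hW'.fderiv_eq, h1.fderiv]
    simp
  rw [lieBracket_eq]
  simp only
  rw [hVe, hWe, hVd, hWd, hF.isSymmSndFDerivAt (by simp) (0, a) (b, 0), sub_self]

section RightInvariant

variable {E : Type*} [NormedAddCommGroup E] [NormedSpace ℝ E]
  {G : Type*} [TopologicalSpace G] [ChartedSpace E G] [Group G]

/-- The right-invariant vector field associated to a vector `v` in the Lie algebra. -/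
def rightInvariantVectorField (v : GroupLieAlgebra 𝓘(ℝ, E) G) (g : G) :
    TangentSpace 𝓘(ℝ, E) g :=
  mfderiv 𝓘(ℝ, E) 𝓘(ℝ, E) (fun x : G => x * g) (1 : G) v

theorem rightInvariantVectorField_one (a : GroupLieAlgebra 𝓘(ℝ, E) G) :
    rightInvariantVectorField a (1 : G) = a := by
  have h : (fun x : G => x * (1 : G)) = id := by ext x; simp
  have h2 : ∀ f : G → G, f = id → ∀ v : E,
      (mfderiv 𝓘(ℝ, E) 𝓘(ℝ, E) f (1 : G) : E → E) v = v := by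
    rintro _ rfl v
    rw [mfderiv_id]; rfl
  exact h2 _ h a

variable [LieGroup 𝓘(ℝ, E) ∞ G]

theorem IsRightInvariant.inner_rightInvariantVectorField {g : Metric E G}
    (hg : IsRightInvariant g) (a b : GroupLieAlgebra 𝓘(ℝ, E) G) (y : G) :
    g.inner y (rightInvariantVectorField a y) (rightInvariantVectorField b y)
      = metricForm g a b :=
  (inner_congr_point g (one_mul y) _ _).symm.trans (hg y 1 a b)

/-- The field is the tangent map of multiplication applied to (v, 0) over (1, g), hence a composite
of C¹ maps. -/
theorem mdiffAt_rightInvariantVectorField (v : GroupLieAlgebra 𝓘(ℝ, E) G) (x : G) :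
    MDiffAt (T% (rightInvariantVectorField v : Π y : G, TangentSpace 𝓘(ℝ, E) y)) x := by
  let fg : G → TangentBundle 𝓘(ℝ, E) G := fun g ↦ TotalSpace.mk' E g 0
  have sfg : CMDiff 1 fg := contMDiff_zeroSection _ _
  let fv : G → TangentBundle 𝓘(ℝ, E) G := fun _ ↦ TotalSpace.mk' E 1 v
  have sfv : CMDiff 1 fv := contMDiff_const
  let F₁ : G → (TangentBundle 𝓘(ℝ, E) G × TangentBundle 𝓘(ℝ, E) G) := fun g ↦ (fv g, fg g)
  have S₁ : CMDiff 1 F₁ := sfv.prodMk sfg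
  let F₂ : (TangentBundle 𝓘(ℝ, E) G × TangentBundle 𝓘(ℝ, E) G) →
      TangentBundle (𝓘(ℝ, E).prod 𝓘(ℝ, E)) (G × G) :=
    (equivTangentBundleProd 𝓘(ℝ, E) G 𝓘(ℝ, E) G).symm
  have S₂ : CMDiff 1 F₂ := contMDiff_equivTangentBundleProd_symm
  let F₃ : TangentBundle (𝓘(ℝ, E).prod 𝓘(ℝ, E)) (G × G) → TangentBundle 𝓘(ℝ, E) G :=
    tangentMap% (fun (p : G × G) ↦ p.1 * p.2)
  have S₃ : CMDiff 1 F₃ := by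
    apply ContMDiff.contMDiff_tangentMap _ (m := 1) le_rfl
    exact (contMDiff_mul 𝓘(ℝ, E) ∞).of_le (by norm_cast)
  let S := (S₃.comp S₂).comp S₁
  refine ContMDiffAt.mdifferentiableAt (n := 1) ?_ one_ne_zero
  refine ContMDiff.contMDiffAt ?_
  convert! S with g
  · simp [F₁, F₂, F₃, fg, fv]
  · have h := mfderiv_prod_eq_add_apply (p := ((1 : G), g)) (v := ((show E from v), (0 : E)))
      ((contMDiff_mul 𝓘(ℝ, E) ∞).mdifferentiable (by simp)).mdifferentiableAt
    refine Eq.trans ?_ h.symm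
    refine (add_zero _).symm.trans (congrArg₂ (· + ·) rfl ?_)
    exact (map_zero (mfderiv 𝓘(ℝ, E) 𝓘(ℝ, E) (fun z : G => 1 * z) g)).symm

end RightInvariant

section Bracket

variable {E : Type*} [NormedAddCommGroup E] [NormedSpace ℝ E]
  {G : Type*} [TopologicalSpace G] [ChartedSpace E G] [Group G] [LieGroup 𝓘(ℝ, E) ∞ G]

variable (E G) in
/-- The multiplication of a Lie group, read in the preferred chart at the identity. -/
def chartMul (p : E × E) : E :=
  extChartAt 𝓘(ℝ, E) (1 : G)
    ((extChartAt 𝓘(ℝ, E) (1 : G)).symm p.1 * (extChartAt 𝓘(ℝ, E) (1 : G)).symm p.2)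

theorem contDiffAt_chartMul :
    ContDiffAt ℝ 2 (chartMul E G) (extChartAt 𝓘(ℝ, E) (1 : G) 1, extChartAt 𝓘(ℝ, E) (1 : G) 1) := by
  set e := extChartAt 𝓘(ℝ, E) (1 : G) 1 with he
  have hs : ContMDiffAt 𝓘(ℝ, E) 𝓘(ℝ, E) 2 (extChartAt 𝓘(ℝ, E) (1 : G)).symm e :=
    (contMDiffOn_extChartAt_symm (1 : G)).contMDiffAt (extChartAt_target_mem_nhds (1 : G))
  rw [← contMDiffAt_iff_contDiffAt]
  have h1 : ContMDiffAt 𝓘(ℝ, E × E) 𝓘(ℝ, E) 2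
      (fun p : E × E => (extChartAt 𝓘(ℝ, E) (1 : G)).symm p.1) (e, e) :=
    ContMDiffAt.comp (g := (extChartAt 𝓘(ℝ, E) (1 : G)).symm) (e, e) hs
      contDiffAt_fst.contMDiffAt
  have h2 : ContMDiffAt 𝓘(ℝ, E × E) 𝓘(ℝ, E) 2
      (fun p : E × E => (extChartAt 𝓘(ℝ, E) (1 : G)).symm p.2) (e, e) :=
    ContMDiffAt.comp (g := (extChartAt 𝓘(ℝ, E) (1 : G)).symm) (e, e) hs
      contDiffAt_snd.contMDiffAt
  have h3 := h1.mul h2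
  refine ContMDiffAt.comp (g := extChartAt 𝓘(ℝ, E) (1 : G))
    (f := fun p : E × E => (extChartAt 𝓘(ℝ, E) (1 : G)).symm p.1
      * (extChartAt 𝓘(ℝ, E) (1 : G)).symm p.2) (e, e) ?_ h3
  simp only [he, extChartAt_to_inv, mul_one]
  exact contMDiffAt_extChartAt

/-- The derivative of `f : G → G` at the identity, read in the preferred chart there. -/
theorem inverse_mfderivWithin_extChartAt_symm_apply {f : G → G} {u : E}
    (hf : MDiffAt f 1) (hu : u ∈ (extChartAt 𝓘(ℝ, E) (1 : G)).target)
    (hfu : f 1 = (extChartAt 𝓘(ℝ, E) (1 : G)).symm u) (a : E) :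
    ((mfderivWithin 𝓘(ℝ, E) 𝓘(ℝ, E) (extChartAt 𝓘(ℝ, E) (1 : G)).symm (Set.range 𝓘(ℝ, E))
        u : E →L[ℝ] E)).inverse
      ((mfderiv 𝓘(ℝ, E) 𝓘(ℝ, E) f 1 : E →L[ℝ] E)
        ((mfderivWithin 𝓘(ℝ, E) 𝓘(ℝ, E) (extChartAt 𝓘(ℝ, E) (1 : G)).symm (Set.range 𝓘(ℝ, E))
          (extChartAt 𝓘(ℝ, E) (1 : G) 1) : E →L[ℝ] E) a))
      = fderiv ℝ (fun v => extChartAt 𝓘(ℝ, E) (1 : G) (f ((extChartAt 𝓘(ℝ, E) (1 : G)).symm v)))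
          (extChartAt 𝓘(ℝ, E) (1 : G) 1) a := by
  set φ := extChartAt 𝓘(ℝ, E) (1 : G) with hφ
  have hrange : Set.range 𝓘(ℝ, E) = Set.univ := by simp
  have hS : ∀ u ∈ φ.target, HasMFDerivAt 𝓘(ℝ, E) 𝓘(ℝ, E) φ.symm u
      (mfderivWithin 𝓘(ℝ, E) 𝓘(ℝ, E) φ.symm (Set.range 𝓘(ℝ, E)) u) := fun u hu => by
    rw [hrange, mfderivWithin_univ]
    exact (((contMDiffOn_extChartAt_symm (n := 1) (1 : G)).contMDiffAt
      ((isOpen_extChartAt_target (1 : G)).mem_nhds hu)).mdifferentiableAt one_ne_zero).hasMFDerivAt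
  have he : φ 1 ∈ φ.target := mem_extChartAt_target (1 : G)
  have hsymm : φ.symm (φ 1) = 1 := extChartAt_to_inv (1 : G)
  have hmem : (f ∘ φ.symm) (φ 1) ∈ φ.source := by
    rw [Function.comp_apply, hsymm, hfu]; exact φ.map_target hu
  have hf' : HasMFDerivAt 𝓘(ℝ, E) 𝓘(ℝ, E) f (φ.symm (φ 1))
      (mfderiv 𝓘(ℝ, E) 𝓘(ℝ, E) f 1 : E →L[ℝ] E) := by
    have : ∀ p : G, p = 1 → HasMFDerivAt 𝓘(ℝ, E) 𝓘(ℝ, E) f p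
        (mfderiv 𝓘(ℝ, E) 𝓘(ℝ, E) f 1 : E →L[ℝ] E) := by
      rintro _ rfl; exact hf.hasMFDerivAt
    exact this _ hsymm
  have hcomp := HasMFDerivAt.comp (φ 1) hf' (hS _ he)
  have hsrc : ∀ᶠ v in 𝓝 (φ 1), (f ∘ φ.symm) v ∈ φ.source :=
    hcomp.continuousAt.eventually_mem ((isOpen_extChartAt_source (1 : G)).mem_nhds hmem)
  have hψ := HasMFDerivAt.comp (φ 1) (MDifferentiableAt.hasMFDerivAt
    (mdifferentiableAt_extChartAt ((extChartAt_source 𝓘(ℝ, E) (1 : G)) ▸ hmem))) hcomp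
  have hψ' : HasMFDerivAt 𝓘(ℝ, E) 𝓘(ℝ, E) (φ ∘ (f ∘ φ.symm)) (φ 1)
      (fderiv ℝ (fun v => φ (f (φ.symm v))) (φ 1)) := by
    rw [hasMFDerivAt_iff_hasFDerivAt] at hψ ⊢
    exact hψ.differentiableAt.hasFDerivAt
  have hSu : HasMFDerivAt 𝓘(ℝ, E) 𝓘(ℝ, E) φ.symm ((φ ∘ (f ∘ φ.symm)) (φ 1))
      (mfderivWithin 𝓘(ℝ, E) 𝓘(ℝ, E) φ.symm (Set.range 𝓘(ℝ, E)) u : E →L[ℝ] E) := by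
    have : ∀ w : E, w = u → HasMFDerivAt 𝓘(ℝ, E) 𝓘(ℝ, E) φ.symm w
        (mfderivWithin 𝓘(ℝ, E) 𝓘(ℝ, E) φ.symm (Set.range 𝓘(ℝ, E)) u : E →L[ℝ] E) := by
      rintro _ rfl; exact hS _ hu
    refine this _ ?_
    rw [Function.comp_apply, Function.comp_apply, hsymm, hfu, φ.right_inv hu]
  have hcomp' := HasMFDerivAt.comp (φ 1) hSu hψ'
  -- The derivative of f ∘ φ⁻¹ is now known in two ways, directly and through the chart expression;
  -- uniqueness of the derivative equates them.
  have heq : φ.symm ∘ (φ ∘ (f ∘ φ.symm)) =ᶠ[𝓝 (φ 1)] f ∘ φ.symm :=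
    hsrc.mono fun v hv => φ.left_inv hv
  have huniq := hasMFDerivAt_unique (hcomp.congr_of_eventuallyEq heq) hcomp'
  have hinv : (mfderivWithin 𝓘(ℝ, E) 𝓘(ℝ, E) φ.symm (Set.range 𝓘(ℝ, E))
      u : E →L[ℝ] E).IsInvertible := isInvertible_mfderivWithin_extChartAt_symm hu
  exact hinv.inverse_apply_eq.2 (congrArg (fun L : E →L[ℝ] E => L a) huniq)

theorem mlieBracket_mulInvariantVectorField_rightInvariantVectorField
    (A B : GroupLieAlgebra 𝓘(ℝ, E) G) :
    mlieBracket 𝓘(ℝ, E) (mulInvariantVectorField A) (rightInvariantVectorField B) (1 : G) = 0 := by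
  set φ := extChartAt 𝓘(ℝ, E) (1 : G) with hφ
  set S : E → E →L[ℝ] E := fun u =>
    mfderivWithin 𝓘(ℝ, E) 𝓘(ℝ, E) φ.symm (Set.range 𝓘(ℝ, E)) u with hS
  have hinv : (S (φ 1)).IsInvertible :=
    isInvertible_mfderivWithin_extChartAt_symm (mem_extChartAt_target (1 : G))
  have hsymm : φ.symm (φ 1) = 1 := extChartAt_to_inv (1 : G)
  have htgt : ∀ᶠ u in 𝓝 (φ 1), u ∈ φ.target := extChartAt_target_mem_nhds (1 : G)
  -- Chart coordinates of `A` and `B` at the identity.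
  obtain ⟨a, ha⟩ : ∃ a, S (φ 1) a = A := ⟨_, hinv.self_apply_inverse A⟩
  obtain ⟨b, hb⟩ : ∃ b, S (φ 1) b = B := ⟨_, hinv.self_apply_inverse B⟩
  have key : ∀ V W : E → E,
      V = mpullbackWithin 𝓘(ℝ, E) 𝓘(ℝ, E) φ.symm (mulInvariantVectorField A)
        (Set.range 𝓘(ℝ, E)) →
      W = mpullbackWithin 𝓘(ℝ, E) 𝓘(ℝ, E) φ.symm (rightInvariantVectorField B)
        (Set.range 𝓘(ℝ, E)) →
      lieBracketWithin ℝ V W (φ.symm ⁻¹' Set.univ ∩ Set.range 𝓘(ℝ, E)) (φ 1) = 0 := by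
    intro V W hV hW
    have hset : φ.symm ⁻¹' Set.univ ∩ Set.range 𝓘(ℝ, E) = Set.univ := by simp
    rw [hset, lieBracketWithin_univ]
    refine lieBracket_partial_fderiv_eq_zero (F := chartMul E G) (a := a) (b := b)
      contDiffAt_chartMul ?_ ?_ ?_ ?_
    · filter_upwards [htgt] with v hv
      simp only [chartMul]
      rw [← hφ, hsymm, one_mul, φ.right_inv hv]
    · filter_upwards [htgt] with v hv
      simp only [chartMul]
      rw [← hφ, hsymm, mul_one, φ.right_inv hv]
    · filter_upwards [htgt] with u hu
      have h1 := inverse_mfderivWithin_extChartAt_symm_apply (E := E)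
        (f := fun y : G => φ.symm u * y)
        ((contMDiff_mul_left (I := 𝓘(ℝ, E)) (n := ∞)).mdifferentiable (by simp)).mdifferentiableAt
        hu (mul_one _) a
      refine Eq.trans ?_ h1
      change V u = (S u).inverse
        ((mfderiv 𝓘(ℝ, E) 𝓘(ℝ, E) (fun y : G => φ.symm u * y) 1 : E →L[ℝ] E) (S (φ 1) a))
      rw [ha, hV]
      rfl
    · filter_upwards [htgt] with u hu
      have h1 := inverse_mfderivWithin_extChartAt_symm_apply (E := E)
        (f := fun y : G => y * φ.symm u)
        ((contMDiff_mul_right (I := 𝓘(ℝ, E)) (n := ∞)).mdifferentiable (by simp)).mdifferentiableAt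
        hu (one_mul _) b
      refine Eq.trans ?_ h1
      change W u = (S u).inverse
        ((mfderiv 𝓘(ℝ, E) 𝓘(ℝ, E) (fun y : G => y * φ.symm u) 1 : E →L[ℝ] E) (S (φ 1) b))
      rw [hb, hW]
      rfl
  rw [← mlieBracketWithin_univ, mlieBracketWithin_apply]
  exact (congrArg _ (key _ _ rfl rfl)).trans (map_zero _)

end Bracket

/-! ### Ad-invariance of bi-invariant metrics. -/

section BiInvariant

variable {E : Type*} [NormedAddCommGroup E] [NormedSpace ℝ E] [FiniteDimensional ℝ E]
  {G : Type*} [TopologicalSpace G] [ChartedSpace E G] [Group G] [LieGroup 𝓘(ℝ, E) ∞ G]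

/-- A bi-invariant metric is `ad`-invariant on the Lie algebra. -/
theorem IsBiInvariant.metricForm_lie_add {g : Metric E G} (hg : IsBiInvariant g)
    (a b c : GroupLieAlgebra 𝓘(ℝ, E) G) :
    metricForm g ⁅a, b⁆ c + metricForm g b ⁅a, c⁆ = 0 := by
  obtain ⟨D, hD⟩ := hg.1.exists_isLeviCivita
  -- The right-invariant extension of `b` commutes with the left-invariant field of `a`, so its
  -- derivative along `a` is ∇_b of that field. Thus ad a is the difference of two operators, each
  -- skew because the metric is constant on left-invariant and on right-invariant fields.
  have hbr : ∀ b, ⁅a, b⁆ = D (mulInvariantVectorField b) 1 a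
      - D (rightInvariantVectorField b) 1 a := fun b => by
    have h1 := hD.sub_eq_mlieBracket (mdiffAt_mulInvariantVectorField a 1)
      (mdiffAt_mulInvariantVectorField b 1)
    have h2 := hD.sub_eq_mlieBracket (mdiffAt_mulInvariantVectorField a 1)
      (mdiffAt_rightInvariantVectorField b 1)
    rw [mlieBracket_mulInvariantVectorField_rightInvariantVectorField] at h2
    rw [mlieBracket_mulInvariantVectorField] at h1
    simp only [mulInvariantVectorField_one, rightInvariantVectorField_one] at h1 h2
    rw [← h1, sub_eq_zero.1 h2]
  have hl := hD.inner_add_inner_eq_zero (x := 1) a (mdiffAt_mulInvariantVectorField b 1)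
    (mdiffAt_mulInvariantVectorField c 1)
    fun z => hg.1.inner_mulInvariantVectorField b c z
  have hr := hD.inner_add_inner_eq_zero (x := 1) a (mdiffAt_rightInvariantVectorField b 1)
    (mdiffAt_rightInvariantVectorField c 1)
    fun z => hg.2.inner_rightInvariantVectorField b c z
  rw [mulInvariantVectorField_one, mulInvariantVectorField_one, ← metricForm_apply,
    ← metricForm_apply] at hl
  rw [rightInvariantVectorField_one, rightInvariantVectorField_one, ← metricForm_apply,
    ← metricForm_apply] at hr
  rw [hbr, hbr, map_sub, map_sub, LinearMap.sub_apply]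
  linarith

end BiInvariant

/-! ### Dependence on the parameter -/

/-- In coordinates Φ_t is the inverse of 1 - tT in a Banach algebra, and inversion is smooth near
the unit 1. -/
theorem contDiffAt_apply_of_symm_eq_sub_smul {V : Type*} [AddCommGroup V] [Module ℝ V]
    [FiniteDimensional ℝ V] {Φ : ℝ → V ≃ₗ[ℝ] V} {Ψ : V →ₗ[ℝ] V}
    (hΨ : ∀ᶠ t in 𝓝 (0 : ℝ), ∀ a, (Φ t).symm a = a - t • Ψ a) (f : V →ₗ[ℝ] ℝ) (a : V)
    (n : ℕ∞ω) : ContDiffAt ℝ n (fun t => f (Φ t a)) 0 := by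
  let e := (Module.finBasis ℝ V).equivFun
  let T : (Fin (Module.finrank ℝ V) → ℝ) →L[ℝ] (Fin (Module.finrank ℝ V) → ℝ) :=
    LinearMap.toContinuousLinearMap (e.toLinearMap ∘ₗ Ψ ∘ₗ e.symm.toLinearMap)
  let F : (Fin (Module.finrank ℝ V) → ℝ) →L[ℝ] ℝ :=
    LinearMap.toContinuousLinearMap (f ∘ₗ e.symm.toLinearMap)
  have hM : ContDiff ℝ n (fun t : ℝ => 1 - t • T) := by fun_prop
  have hunit : ∀ᶠ t in 𝓝 (0 : ℝ), IsUnit (1 - t • T) := by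
    refine hM.continuous.continuousAt.eventually_mem (Units.isOpen.mem_nhds ?_)
    simp
  have hinv : ContDiffAt ℝ n (fun t : ℝ => Ring.inverse (1 - t • T)) 0 := by
    refine ContDiffAt.comp (g := Ring.inverse) (f := fun t : ℝ => 1 - t • T) (0 : ℝ) ?_
      hM.contDiffAt
    have := contDiffAt_ringInverse ℝ (n := n)
      (1 : ((Fin (Module.finrank ℝ V) → ℝ) →L[ℝ] (Fin (Module.finrank ℝ V) → ℝ))ˣ)
    simpa using this
  have hmain : ContDiffAt ℝ n (fun t : ℝ => F (Ring.inverse (1 - t • T) (e a))) 0 :=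
    F.contDiff.contDiffAt.comp (0 : ℝ) (hinv.clm_apply contDiffAt_const)
  refine hmain.congr_of_eventuallyEq ?_
  filter_upwards [hΨ, hunit] with t ht hu
  have h1 : (1 - t • T) (e (Φ t a)) = e a := by
    have h2 : Φ t a - t • Ψ (Φ t a) = a := by rw [← ht, LinearEquiv.symm_apply_apply]
    conv_rhs => rw [← h2]
    simp [T]
  have h3 : e (Φ t a) = Ring.inverse (1 - t • T) (e a) := by
    rw [← h1, ← mul_apply_eq_comp, Ring.inverse_mul_cancel _ hu]
    rfl
  rw [← h3]
  simp [F]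

/-- In Leibniz' formula only the third derivative of t³ survives at 0, and it equals 6. -/
theorem iteratedDeriv_pow_three_mul {s : ℝ → ℝ} (hs : ContDiffAt ℝ 3 s 0) :
    deriv (fun t => t ^ 3 * s t) 0 = 0 ∧ iteratedDeriv 2 (fun t => t ^ 3 * s t) 0 = 0 ∧
      iteratedDeriv 3 (fun t => t ^ 3 * s t) 0 = 6 * s 0 := by
  have hp : ∀ n : ℕ∞ω, ContDiffAt ℝ n (fun t : ℝ => t ^ 3) 0 := fun n =>
    (contDiff_id.pow 3).contDiffAt
  have key : ∀ n : ℕ, n ≤ 3 → iteratedDeriv n (fun t => t ^ 3 * s t) 0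
      = ∑ i ∈ Finset.range (n + 1), (n.choose i : ℝ) * iteratedDeriv i (fun t : ℝ => t ^ 3) 0
        * iteratedDeriv (n - i) s 0 := fun n hn =>
    iteratedDeriv_fun_mul (hp n) (hs.of_le (by exact_mod_cast hn))
  refine ⟨?_, ?_, ?_⟩
  · rw [← iteratedDeriv_one, key 1 (by norm_num)]
    simp [Finset.sum_range_succ]
  · rw [key 2 (by norm_num)]
    simp [Finset.sum_range_succ]
  · rw [key 3 le_rfl]
    simp [Finset.sum_range_succ]

section Family

attribute [local instance] lieGroup_minSmoothness finiteDimensional_tangentSpace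

theorem exists_curvature_eq_pow_three_mul
    {E : Type*} [NormedAddCommGroup E] [NormedSpace ℝ E] [FiniteDimensional ℝ E]
    {G : Type*} [TopologicalSpace G] [ChartedSpace E G] [Group G] [LieGroup 𝓘(ℝ, E) ∞ G]
    {ε : ℝ} (hε : 0 < ε) {h : ℝ → Metric E G}
    (h_left : ∀ t ∈ Set.Ioo (-ε) ε, IsLeftInvariant (h t)) (h_bi : IsBiInvariant (h 0))
    {Φ : ℝ → (GroupLieAlgebra 𝓘(ℝ, E) G ≃ₗ[ℝ] GroupLieAlgebra 𝓘(ℝ, E) G)}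
    (hΦ : ∀ t ∈ Set.Ioo (-ε) ε, ∀ A B : GroupLieAlgebra 𝓘(ℝ, E) G,
      metricForm (h t) A B = metricForm (h 0) (Φ t A) B)
    {Ψ : GroupLieAlgebra 𝓘(ℝ, E) G →ₗ[ℝ] GroupLieAlgebra 𝓘(ℝ, E) G}
    (hΨ : ∀ t ∈ Set.Ioo (-ε) ε, ∀ A : GroupLieAlgebra 𝓘(ℝ, E) G,
      (Φ t).symm A = A - t • Ψ A)
    {X Y : GroupLieAlgebra 𝓘(ℝ, E) G} (hXY : ⁅X, Y⁆ = 0) :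
    ∃ s : ℝ → ℝ, ContDiffAt ℝ 3 s 0 ∧
      s 0 = metricForm (h 0) (⁅X, Ψ Y⁆ + ⁅Ψ X, Y⁆) ⁅Ψ X, Ψ Y⁆
          + metricForm (h 0) ⁅Ψ X, X⁆ (Ψ ⁅Ψ Y, Y⁆)
          - metricForm (h 0) ⁅X, Ψ Y⁆ (Ψ ⁅X, Ψ Y⁆)
          - metricForm (h 0) ⁅X, Ψ Y⁆ (Ψ ⁅Ψ X, Y⁆)
          - metricForm (h 0) ⁅Ψ X, Y⁆ (Ψ ⁅Ψ X, Y⁆) ∧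
      ∀ t ∈ Set.Ioo (-ε) ε,
        lieSectionalCurvature (h t) ((Φ t).symm X) ((Φ t).symm Y) = t ^ 3 * s t := by
  have hΨs : ∀ a b, metricForm (h 0) (Ψ a) b = metricForm (h 0) (Ψ b) a := fun a b => by
    -- Self-adjointness of Ψ follows from symmetry of `h t` at any single nonzero t; ε/2 is one.
    have hm : ε / 2 ∈ Set.Ioo (-ε) ε := ⟨by linarith, by linarith⟩
    have h1 := hΦ _ hm ((Φ (ε / 2)).symm a) ((Φ (ε / 2)).symm b)
    rw [metricForm_symm, hΦ _ hm, LinearEquiv.apply_symm_apply, LinearEquiv.apply_symm_apply,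
      hΨ _ hm, hΨ _ hm] at h1
    simp only [map_sub, map_smul, smul_eq_mul] at h1
    rw [metricForm_symm (h 0) b a, metricForm_symm (h 0) b, metricForm_symm (h 0) a (Ψ b)] at h1
    have h2 : ε / 2 * (metricForm (h 0) (Ψ a) b - metricForm (h 0) (Ψ b) a) = 0 := by linarith
    rcases mul_eq_zero.1 h2 with h3 | h3
    · linarith
    · linarith
  have hev : ∀ᶠ t in 𝓝 (0 : ℝ), ∀ a, (Φ t).symm a = a - t • Ψ a :=
    Filter.mem_of_superset (Ioo_mem_nhds (by linarith) hε) hΨ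
  have hsm : ∀ a b, ContDiffAt ℝ 3 (fun t => metricForm (h 0) (Φ t a) b) 0 := fun a b =>
    contDiffAt_apply_of_symm_eq_sub_smul hev ((metricForm (h 0)).flip b) a 3
  set v := ⁅X, Ψ Y⁆ + ⁅Ψ X, Y⁆ with hv
  set w := ⁅Ψ X, Ψ Y⁆ with hw
  -- The witness is the cofactor of t³ in `curvature_expansion`; its second summand carries a factor
  -- t and vanishes at 0.
  refine ⟨fun t => metricForm (h 0) v w + metricForm (h 0) ⁅Ψ X, X⁆ (Ψ ⁅Ψ Y, Y⁆)
      - metricForm (h 0) ⁅X, Ψ Y⁆ (Ψ ⁅X, Ψ Y⁆) - metricForm (h 0) ⁅X, Ψ Y⁆ (Ψ ⁅Ψ X, Y⁆)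
      - metricForm (h 0) ⁅Ψ X, Y⁆ (Ψ ⁅Ψ X, Y⁆)
      + t * (-(3 / 4) * (metricForm (h 0) w w - 2 * metricForm (h 0) (Ψ v) w
        + t * metricForm (h 0) (Ψ w) w + metricForm (h 0) (Φ t (Ψ (Ψ v))) v
        - t * (metricForm (h 0) (Φ t (Ψ (Ψ v))) w + metricForm (h 0) (Φ t (Ψ (Ψ w))) v)
        + t ^ 2 * metricForm (h 0) (Φ t (Ψ (Ψ w))) w)), ?_, by simp, fun t ht => ?_⟩
  · have h1 := hsm (Ψ (Ψ v)) v
    have h2 := hsm (Ψ (Ψ v)) w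
    have h3 := hsm (Ψ (Ψ w)) v
    have h4 := hsm (Ψ (Ψ w)) w
    fun_prop
  · obtain ⟨N, hN⟩ := exists_isLeviCivitaProduct (metricForm_symm (h t)) (metricForm_pos (h t))
    rw [lieSectionalCurvature_eq (h_left t ht) (h_left t ht).exists_isLeviCivita hN]
    exact curvature_expansion (metricForm_symm (h 0)) (metricForm_pos (h 0))
      h_bi.metricForm_lie_add (metricForm_symm (h t)) (hΦ t ht) hΨs (hΨ t ht) hXY hN hv hw
      rfl rfl

end Family

end LieGroupCurvature

end

theorem lemma2
    {E : Type*} [NormedAddCommGroup E] [NormedSpace ℝ E] [FiniteDimensional ℝ E]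
    {G : Type*} [TopologicalSpace G] [ChartedSpace E G] [Group G] [LieGroup 𝓘(ℝ, E) ∞ G]
    [CompactSpace G]
    (ε : ℝ) (hε : 0 < ε)
    (h : ℝ → LieGroupCurvature.Metric E G)
    (h_left : ∀ t ∈ Set.Ioo (-ε) ε, LieGroupCurvature.IsLeftInvariant (h t))
    (h_bi : LieGroupCurvature.IsBiInvariant (h 0))
    (Φ : ℝ → (GroupLieAlgebra 𝓘(ℝ, E) G ≃ₗ[ℝ] GroupLieAlgebra 𝓘(ℝ, E) G))
    (hΦ : ∀ t ∈ Set.Ioo (-ε) ε, ∀ A B : GroupLieAlgebra 𝓘(ℝ, E) G,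
      (h t).inner 1 A B = (h 0).inner 1 (Φ t A) B)
    (Ψ : GroupLieAlgebra 𝓘(ℝ, E) G →ₗ[ℝ] GroupLieAlgebra 𝓘(ℝ, E) G)
    (hΨ : ∀ t ∈ Set.Ioo (-ε) ε, ∀ A : GroupLieAlgebra 𝓘(ℝ, E) G,
      (Φ t).symm A = A - t • Ψ A)
    (X Y : GroupLieAlgebra 𝓘(ℝ, E) G) (hXY : ⁅X, Y⁆ = 0)
    (κ : ℝ → ℝ)
    (hκ : ∀ t ∈ Set.Ioo (-ε) ε,
      κ t = LieGroupCurvature.lieSectionalCurvature (h t) ((Φ t).symm X) ((Φ t).symm Y)) :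
    ContDiffAt ℝ 3 κ 0 ∧ κ 0 = 0 ∧ deriv κ 0 = 0 ∧ iteratedDeriv 2 κ 0 = 0 ∧
      (1 / 6 : ℝ) * iteratedDeriv 3 κ 0
        = (h 0).inner 1 (⁅X, Ψ Y⁆ + ⁅Ψ X, Y⁆) ⁅Ψ X, Ψ Y⁆
          + (h 0).inner 1 ⁅Ψ X, X⁆ (Ψ ⁅Ψ Y, Y⁆)
          - (h 0).inner 1 ⁅X, Ψ Y⁆ (Ψ ⁅X, Ψ Y⁆)
          - (h 0).inner 1 ⁅X, Ψ Y⁆ (Ψ ⁅Ψ X, Y⁆)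
          - (h 0).inner 1 ⁅Ψ X, Y⁆ (Ψ ⁅Ψ X, Y⁆) := by
  obtain ⟨s, hs, hs0, hcurv⟩ := LieGroupCurvature.exists_curvature_eq_pow_three_mul hε h_left h_bi
    hΦ hΨ hXY
  have hκs : ∀ t ∈ Set.Ioo (-ε) ε, κ t = t ^ 3 * s t := fun t ht => (hκ t ht).trans (hcurv t ht)
  have hev : κ =ᶠ[𝓝 0] fun t => t ^ 3 * s t :=
    Filter.mem_of_superset (Ioo_mem_nhds (by linarith) hε) hκs
  obtain ⟨h1, h2, h3⟩ := LieGroupCurvature.iteratedDeriv_pow_three_mul hs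
  refine ⟨?_, ?_, ?_, ?_, ?_⟩
  · exact ((contDiff_id.pow 3).contDiffAt.mul hs).congr_of_eventuallyEq hev
  · rw [hev.self_of_nhds]; simp
  · rw [hev.deriv_eq, h1]
  · rw [hev.iteratedDeriv_eq 2, h2]
  · rw [hev.iteratedDeriv_eq 3, h3, hs0]
    simp only [LieGroupCurvature.metricForm_apply]
    ring
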